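/- Let $\mathcal W\in L^1(\mathbb R)$ be real-valued and even, with $\int_{\mathbb R}\mathcal W=1$ and $\mathcal W\ge 0$ a.e., and suppose that there are $\tau>0$ and $\sigma>0$ with $\mathcal W\ge\sigma$ a.e. on $(-\tau,\tau)$. For $s\ge 0$ let $$\widecheck{\mathcal W}(s)=\lim_{R\to\infty}\int_{-R}^{\infty}\mathcal W(y)e^{-sy}\,dy\in\mathbb R\cup\{\infty\},$$ and assume that $s^2-2\widecheck{\mathcal W}(s)<0$ for all $s\ge 0$. Let $u:\mathbb R\to\mathbb C$ belong to the energy space $$\mathcal E(\mathbb R)=\{v\in H^1_{\mathrm{loc}}(\mathbb R;\mathbb C):\ 1-|v|^2\in L^2(\mathbb R),\ v'\in L^2(\mathbb R)\}$$ and be a nonconstant solution, in the sense of distributions, of $$u''+u\,\bigl(\mathcal W*(1-|u|^2)\bigr)=0\quad\text{in }\mathbb R,$$ with $u(x)\to 1$ as $x\to+\infty$ and $u(x)\to-1$ as $x\to-\infty$. Then $u$ is not nondecreasing on $\mathbb R$, i.e. $u$ does not coincide a.e. with a real-valued nondecreasing function. -/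

import Mathlib

open MeasureTheory Filter Topology Set
open scoped ContDiff

noncomputable section

/-- The truncated two-sided Laplace transform `∫_{-R}^∞ W(y) e^{-s y} dy`. -/
def truncatedLaplace (W : ℝ → ℝ) (s R : ℝ) : ℝ :=
  ∫ y in Ioi (-R), W y * Real.exp (-s * y)

/-- The generalized Laplace transform of an integrable nonnegative `W`, with values in the
extended reals: the limit of the truncated transforms as `R → ∞`. The limit exists for
`s ≥ 0`, see `tendsto_truncatedLaplace`. -/
def generalizedLaplace (W : ℝ → ℝ) (s : ℝ) : EReal :=
  limUnder atTop fun R : ℝ => ((truncatedLaplace W s R : ℝ) : EReal)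

theorem integrableOn_laplace {W : ℝ → ℝ} (hW : Integrable W) {s : ℝ} (hs : 0 ≤ s) (R : ℝ) :
    IntegrableOn (fun y => W y * Real.exp (-s * y)) (Ioi (-R)) := by
  refine Integrable.mono' (hW.norm.restrict.const_mul (Real.exp (s * R)))
    (hW.aestronglyMeasurable.restrict.mul (by fun_prop)) ?_
  filter_upwards [ae_restrict_mem measurableSet_Ioi] with y hy
  have hy' : -R < y := hy
  rw [norm_mul, mul_comm, Real.norm_of_nonneg (Real.exp_pos _).le]
  exact mul_le_mul_of_nonneg_right (Real.exp_le_exp.2 (by nlinarith)) (norm_nonneg _)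

theorem tendsto_truncatedLaplace {W : ℝ → ℝ} (hW : Integrable W) (hpos : ∀ᵐ x, 0 ≤ W x)
    {s : ℝ} (hs : 0 ≤ s) :
    Tendsto (fun R : ℝ => ((truncatedLaplace W s R : ℝ) : EReal)) atTop
      (𝓝 (generalizedLaplace W s)) := by
  refine tendsto_nhds_limUnder ⟨_, tendsto_atTop_iSup ?_⟩
  intro R R' h
  refine EReal.coe_le_coe_iff.2 (setIntegral_mono_set (integrableOn_laplace hW hs R') ?_ ?_)
  · filter_upwards [ae_restrict_of_ae hpos] with y hy
    exact mul_nonneg hy (Real.exp_pos _).le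
  · exact (Ioi_subset_Ioi (neg_le_neg h)).eventuallyLE

/-- `g` is the weak (distributional) derivative of `u` on `ℝ`. -/
structure HasWeakDeriv (u g : ℝ → ℂ) : Prop where
  locallyIntegrable : LocallyIntegrable u
  locallyIntegrable_deriv : LocallyIntegrable g
  integral_eq : ∀ φ : ℝ → ℝ, ContDiff ℝ ∞ φ → HasCompactSupport φ →
    ∫ x, deriv φ x • u x = -∫ x, φ x • g x

/-- The energy space: `u ∈ H¹_loc(ℝ)` complex valued, `1 - |u|² ∈ L²(ℝ)` and `u' ∈ L²(ℝ)`. -/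
structure MemEnergySpace (u : ℝ → ℂ) : Prop where
  memLp_loc : ∀ K : Set ℝ, IsCompact K → MemLp u 2 (volume.restrict K)
  memLp_density : MemLp (fun x => 1 - ‖u x‖ ^ 2) 2
  exists_weakDeriv : ∃ g : ℝ → ℂ, HasWeakDeriv u g ∧ MemLp g 2

/-- The convolution `W * (1 - |u|²)`. -/
def nonlocalTerm (W : ℝ → ℝ) (u : ℝ → ℂ) : ℝ → ℝ :=
  convolution W (fun x => 1 - ‖u x‖ ^ 2) (ContinuousLinearMap.mul ℝ ℝ) volume

/-- `u'' + u (W * (1 - |u|²)) = 0` on `ℝ`, in the sense of distributions. (For `W ∈ L¹(ℝ)` and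
`u` in the energy space, both terms are locally integrable.) -/
def IsStaticSolution (W : ℝ → ℝ) (u : ℝ → ℂ) : Prop :=
  ∀ φ : ℝ → ℝ, ContDiff ℝ ∞ φ → HasCompactSupport φ →
    ∫ x, (iteratedDeriv 2 φ x • u x + (φ x * nonlocalTerm W u x) • u x) = 0

end

/-! Suppose `u` agrees a.e. with a nondecreasing real `v`. Then `w = 1 - v` is nonnegative and
satisfies `w'' = v · W * (w (1 + v))`, which at `+∞` linearizes to `w'' = 2 W * w`. An exponential
tail `e^{-sx}` would need `s² = 2 Ŵ(s)`, with `Ŵ` the Laplace transform, whereas the assumption says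
`s² < 2 Ŵ(s)` for every `s ≥ 0`. So `w` can have no positive tail.

To make this rigorous without any a priori decay of `w`, or finiteness of `Ŵ`, the equation is
tested with a wide Gaussian `g(t) = exp(-ε t²/2)`. At distance `t` from its centre it acts like an
exponential of slope `s = ε t`: `g'' = g (s² - ε)`, and `W` correlated with `g` gives `g` times
`gaussianLaplace W ε s`, which is always finite. `exists_forall_sq_lt_gaussianLaplace` chooses one
`ε` for which the strict inequality holds at all slopes, even after 2 is lowered to `(1 - ε)(2 -
ε)`; these factors bound `v` and `1 + v` from below where `v ≥ 1 - ε`. The term `-ε g w` is then a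
net gain. Cutting the Gaussian off costs at most a polynomial in the half-width `L` times its value
near the edge, while the gain one unit further in is exponentially larger in `L`. This is
`MonotoneProfile.mul_exp_le`; letting `L → ∞` contradicts `v < 1`, which is
`MonotoneProfile.lt_one`. -/

/-! ### Gaussian-regularized Laplace transform and a uniform choice of `ε`. -/

/-- The Laplace transform of `W` against the Gaussian weight `exp (-ε t² / 2)`. -/
noncomputable def gaussianLaplace (W : ℝ → ℝ) (ε s : ℝ) : ℝ :=
  ∫ t, W t * Real.exp (-s * t - ε * t ^ 2 / 2)

/-- Completing the square in `t`. The bound is uniform in `t`, so integrability of `W` alone makes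
the transform finite and continuous in `s`. -/
theorem exp_gaussianLaplace_le {ε s A t : ℝ} (hε : 0 < ε) (hs : |s| ≤ A) :
    Real.exp (-s * t - ε * t ^ 2 / 2) ≤ Real.exp (A ^ 2 / (2 * ε)) := by
  have h1 : s ^ 2 ≤ A ^ 2 := sq_le_sq' (by linarith [neg_abs_le s]) (by linarith [le_abs_self s])
  rw [Real.exp_le_exp, le_div_iff₀ (by positivity)]
  nlinarith [sq_nonneg (s + ε * t)]

theorem integrable_gaussianLaplace {W : ℝ → ℝ} (hW : Integrable W) {ε : ℝ} (hε : 0 < ε) (s : ℝ) :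
    Integrable fun t => W t * Real.exp (-s * t - ε * t ^ 2 / 2) := by
  refine hW.mul_bdd (c := Real.exp (|s| ^ 2 / (2 * ε)))
    (by fun_prop) (Eventually.of_forall fun t => ?_)
  rw [Real.norm_of_nonneg (Real.exp_pos _).le]
  exact exp_gaussianLaplace_le hε le_rfl

theorem gaussianLaplace_nonneg {W : ℝ → ℝ} (hpos : ∀ᵐ x, 0 ≤ W x) (ε s : ℝ) :
    0 ≤ gaussianLaplace W ε s := by
  refine integral_nonneg_of_ae ?_
  filter_upwards [hpos] with t ht using mul_nonneg ht (Real.exp_pos _).le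

theorem gaussianLaplace_anti {W : ℝ → ℝ} (hW : Integrable W) (hpos : ∀ᵐ x, 0 ≤ W x)
    {ε ε' : ℝ} (hε : 0 < ε) (h : ε ≤ ε') (s : ℝ) :
    gaussianLaplace W ε' s ≤ gaussianLaplace W ε s := by
  refine integral_mono_ae (integrable_gaussianLaplace hW (hε.trans_le h) s)
    (integrable_gaussianLaplace hW hε s) ?_
  filter_upwards [hpos] with t ht
  refine mul_le_mul_of_nonneg_left (Real.exp_le_exp.2 ?_) ht
  nlinarith [sq_nonneg t]

theorem gaussianLaplace_neg {W : ℝ → ℝ} (heven : ∀ᵐ x, W (-x) = W x) (ε s : ℝ) :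
    gaussianLaplace W ε (-s) = gaussianLaplace W ε s := by
  unfold gaussianLaplace
  rw [← integral_neg_eq_self]
  refine integral_congr_ae ?_
  filter_upwards [heven] with t ht
  simp only [ht]
  ring_nf

theorem continuous_gaussianLaplace {W : ℝ → ℝ} (hW : Integrable W) {ε : ℝ} (hε : 0 < ε) :
    Continuous (gaussianLaplace W ε) := by
  refine continuous_iff_continuousAt.2 fun s₀ => ?_
  refine continuousAt_of_dominated (F := fun s t => W t * Real.exp (-s * t - ε * t ^ 2 / 2))
    (bound := fun t => ‖W t‖ * Real.exp ((|s₀| + 1) ^ 2 / (2 * ε)))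
    (Eventually.of_forall fun s => (integrable_gaussianLaplace hW hε s).aestronglyMeasurable)
    ?_ (hW.norm.mul_const _) (Eventually.of_forall fun t => by fun_prop)
  filter_upwards [Metric.ball_mem_nhds s₀ one_pos] with s hs
  refine Eventually.of_forall fun t => ?_
  rw [norm_mul, Real.norm_of_nonneg (Real.exp_pos _).le]
  refine mul_le_mul_of_nonneg_left (exp_gaussianLaplace_le hε ?_) (norm_nonneg _)
  rw [Metric.mem_ball, Real.dist_eq] at hs
  linarith [abs_sub_abs_le_abs_sub s s₀]

theorem exists_lt_truncatedLaplace {W : ℝ → ℝ} (hW : Integrable W) (hpos : ∀ᵐ x, 0 ≤ W x)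
    {s : ℝ} (hs : 0 ≤ s) (h : ((s ^ 2 : ℝ) : EReal) - 2 * generalizedLaplace W s < 0) :
    ∃ R, s ^ 2 < 2 * truncatedLaplace W s R := by
  by_contra! hcon
  have hle : generalizedLaplace W s ≤ ((s ^ 2 / 2 : ℝ) : EReal) :=
    le_of_tendsto' (tendsto_truncatedLaplace hW hpos hs) fun R =>
      EReal.coe_le_coe_iff.2 (by linarith [hcon R])
  generalize generalizedLaplace W s = l at h hle
  induction l with
  | bot =>
    rw [EReal.mul_bot_of_pos (by norm_num), EReal.sub_bot (EReal.coe_ne_bot _)] at h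
    exact absurd h (by simp)
  | top => exact absurd hle (by simp)
  | coe r =>
    have hr := EReal.coe_le_coe_iff.1 hle
    have h2 : ((s ^ 2 : ℝ) : EReal) - 2 * (r : EReal) = ((s ^ 2 - 2 * r : ℝ) : EReal) := by
      push_cast; rfl
    rw [h2] at h
    have := EReal.coe_lt_coe_iff.1 (h : ((s ^ 2 - 2 * r : ℝ) : EReal) < ((0 : ℝ) : EReal))
    linarith

/-- On a fixed half-line `(-R, ∞)` the Gaussian factor disappears as `ε → 0` by dominated
convergence, and `(1 - ε)(2 - ε) → 2`; restoring the rest of the line only increases the integral.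
-/
theorem exists_sq_lt_gaussianLaplace {W : ℝ → ℝ} (hW : Integrable W) (hpos : ∀ᵐ x, 0 ≤ W x)
    {s : ℝ} (hs : 0 ≤ s) (h : ((s ^ 2 : ℝ) : EReal) - 2 * generalizedLaplace W s < 0) :
    ∃ ε ∈ Ioo (0 : ℝ) 1, s ^ 2 < (1 - ε) * (2 - ε) * gaussianLaplace W ε s := by
  obtain ⟨R, hR⟩ := exists_lt_truncatedLaplace hW hpos hs h
  have hlim : Tendsto (fun ε : ℝ => ∫ t in Ioi (-R), W t * Real.exp (-s * t - ε * t ^ 2 / 2))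
      (𝓝[>] 0) (𝓝 (truncatedLaplace W s R)) := by
    refine tendsto_integral_filter_of_dominated_convergence
      (fun t => ‖W t * Real.exp (-s * t)‖) ?_ ?_ (integrableOn_laplace hW hs R).norm ?_
    · filter_upwards [self_mem_nhdsWithin] with ε hε
      exact (integrable_gaussianLaplace hW hε s).aestronglyMeasurable.restrict
    · filter_upwards [self_mem_nhdsWithin] with ε hε
      refine Eventually.of_forall fun t => ?_
      rw [norm_mul, norm_mul, Real.norm_of_nonneg (Real.exp_pos _).le,
        Real.norm_of_nonneg (Real.exp_pos _).le]
      refine mul_le_mul_of_nonneg_left (Real.exp_le_exp.2 ?_) (norm_nonneg _)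
      have : (0 : ℝ) < ε := hε
      nlinarith [mul_nonneg this.le (sq_nonneg t)]
    · refine Eventually.of_forall fun t => ?_
      have : Continuous fun ε : ℝ => W t * Real.exp (-s * t - ε * t ^ 2 / 2) := by fun_prop
      simpa using (this.tendsto 0).mono_left nhdsWithin_le_nhds
  have hκ : Tendsto (fun ε : ℝ => (1 - ε) * (2 - ε)) (𝓝[>] 0) (𝓝 2) := by
    have : Continuous fun ε : ℝ => (1 - ε) * (2 - ε) := by fun_prop
    simpa using (this.tendsto 0).mono_left nhdsWithin_le_nhds
  have hev := (hκ.mul hlim).eventually_const_lt hR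
  have hIoo : ∀ᶠ ε : ℝ in 𝓝[>] 0, ε ∈ Ioo (0 : ℝ) 1 := Ioo_mem_nhdsGT one_pos
  obtain ⟨ε, hlt, hε⟩ := (hev.and hIoo).exists
  refine ⟨ε, hε, hlt.trans_le (mul_le_mul_of_nonneg_left ?_ ?_)⟩
  · refine setIntegral_le_integral (integrable_gaussianLaplace hW hε.1 s) ?_
    filter_upwards [hpos] with t ht using mul_nonneg ht (Real.exp_pos _).le
  · nlinarith [hε.1, hε.2]

/-- The mass of `W` on `(-τ, -τ/2)` makes the transform grow at least like `e^{sτ/2}`, which beats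
`s²`. The value `ε = 1/2` is only a convenient choice in `(0, 1)`. -/
theorem exists_forall_ge_sq_lt_gaussianLaplace {W : ℝ → ℝ} (hW : Integrable W)
    (hpos : ∀ᵐ x, 0 ≤ W x) {τ σ : ℝ} (hτ : 0 < τ) (hσ : 0 < σ)
    (hlower : ∀ᵐ x, x ∈ Ioo (-τ) τ → σ ≤ W x) :
    ∃ S : ℝ, ∀ s, S ≤ s →
      s ^ 2 < (1 - 1 / 2) * (2 - 1 / 2) * gaussianLaplace W (1 / 2) s := by
  have hbound : ∀ s : ℝ, 0 ≤ s →
      (τ / 2) * (σ * Real.exp (s * (τ / 2) - τ ^ 2 / 4)) ≤ gaussianLaplace W (1 / 2) s := by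
    intro s hs
    calc (τ / 2) * (σ * Real.exp (s * (τ / 2) - τ ^ 2 / 4))
        = ∫ _ in Ioo (-τ) (-(τ / 2)), σ * Real.exp (s * (τ / 2) - τ ^ 2 / 4) := by
          rw [setIntegral_const, smul_eq_mul]
          simp only [measureReal_def, Real.volume_Ioo]
          rw [ENNReal.toReal_ofReal (by linarith)]
          ring
      _ ≤ ∫ t in Ioo (-τ) (-(τ / 2)), W t * Real.exp (-s * t - 1 / 2 * t ^ 2 / 2) := by
          refine setIntegral_mono_on_ae (integrable_const _)
            (integrable_gaussianLaplace hW (by norm_num) s).integrableOn measurableSet_Ioo ?_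
          filter_upwards [hlower] with t ht hmem
          refine mul_le_mul (ht ⟨hmem.1, by linarith [hmem.2]⟩) (Real.exp_le_exp.2 ?_)
            (Real.exp_pos _).le (hσ.le.trans (ht ⟨hmem.1, by linarith [hmem.2]⟩))
          have h1 := hmem.1
          have h2 := hmem.2
          nlinarith [mul_nonneg hs (by linarith : 0 ≤ -t - τ / 2)]
      _ ≤ _ := by
          refine setIntegral_le_integral (integrable_gaussianLaplace hW (by norm_num) s) ?_
          filter_upwards [hpos] with t ht using mul_nonneg ht (Real.exp_pos _).le
  set c := (1 - 1 / 2) * (2 - 1 / 2) * ((τ / 2) * (σ * Real.exp (-(τ ^ 2 / 4)))) with hc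
  have hcpos : 0 < c := by positivity
  have hlim : Tendsto (fun s : ℝ => Real.exp (τ / 2 * s) / s ^ (2 : ℝ)) atTop atTop :=
    tendsto_exp_mul_div_rpow_atTop 2 (τ / 2) (by positivity)
  obtain ⟨S, hS⟩ := eventually_atTop.1
    ((hlim.eventually_gt_atTop (1 / c)).and (eventually_gt_atTop 0))
  refine ⟨S, fun s hs => ?_⟩
  obtain ⟨h1, h2⟩ := hS s hs
  rw [Real.rpow_two, div_lt_div_iff₀ hcpos (by positivity)] at h1
  have h3 := hbound s h2.le
  have h4 : Real.exp (s * (τ / 2) - τ ^ 2 / 4)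
      = Real.exp (τ / 2 * s) * Real.exp (-(τ ^ 2 / 4)) := by
    rw [← Real.exp_add]; ring_nf
  rw [h4] at h3
  calc s ^ 2 < Real.exp (τ / 2 * s) * c := by linarith
    _ = (1 - 1 / 2) * (2 - 1 / 2) *
        ((τ / 2) * (σ * (Real.exp (τ / 2 * s) * Real.exp (-(τ ^ 2 / 4))))) := by rw [hc]; ring
    _ ≤ _ := mul_le_mul_of_nonneg_left h3 (by norm_num)

/-- Decreasing `ε` preserves the inequality, so finitely many choices combine by taking the minimum:
compactness handles `[0, S]`, exponential growth handles `s ≥ S`, and evenness of `W` gives `s < 0`.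
Negative slopes matter because the Gaussian has two sides. -/
theorem exists_forall_sq_lt_gaussianLaplace {W : ℝ → ℝ} (hW : Integrable W)
    (heven : ∀ᵐ x, W (-x) = W x) (hpos : ∀ᵐ x, 0 ≤ W x) {τ σ : ℝ} (hτ : 0 < τ) (hσ : 0 < σ)
    (hlower : ∀ᵐ x, x ∈ Ioo (-τ) τ → σ ≤ W x)
    (hlap : ∀ s : ℝ, 0 ≤ s → ((s ^ 2 : ℝ) : EReal) - 2 * generalizedLaplace W s < 0) :
    ∃ ε ∈ Ioo (0 : ℝ) 1, ∀ s, s ^ 2 < (1 - ε) * (2 - ε) * gaussianLaplace W ε s := by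
  have hanti : ∀ {ε ε' s : ℝ}, 0 < ε → ε ≤ ε' → ε' < 1 →
      (1 - ε') * (2 - ε') * gaussianLaplace W ε' s ≤ (1 - ε) * (2 - ε) * gaussianLaplace W ε s :=
    fun h0 h1 h2 => mul_le_mul (by nlinarith) (gaussianLaplace_anti hW hpos h0 h1 _)
      (gaussianLaplace_nonneg hpos _ _) (by nlinarith)
  let p : Set ℝ → Prop := fun T =>
    ∃ ε ∈ Ioo (0 : ℝ) 1, ∀ s ∈ T, s ^ 2 < (1 - ε) * (2 - ε) * gaussianLaplace W ε s
  have hunion : ∀ T₁ T₂, p T₁ → p T₂ → p (T₁ ∪ T₂) := by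
    rintro T₁ T₂ ⟨ε₁, h₁, H₁⟩ ⟨ε₂, h₂, H₂⟩
    refine ⟨min ε₁ ε₂, ⟨lt_min h₁.1 h₂.1, (min_le_left _ _).trans_lt h₁.2⟩, ?_⟩
    rintro s (hs | hs)
    · exact (H₁ s hs).trans_le (hanti (lt_min h₁.1 h₂.1) (min_le_left _ _) h₁.2)
    · exact (H₂ s hs).trans_le (hanti (lt_min h₁.1 h₂.1) (min_le_right _ _) h₂.2)
  obtain ⟨S, hS⟩ := exists_forall_ge_sq_lt_gaussianLaplace hW hpos hτ hσ hlower
  have hcompact : p (Icc 0 S) := by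
    refine isCompact_Icc.induction_on ⟨1 / 2, by norm_num, by simp⟩ ?_ hunion ?_
    · rintro T₁ T₂ hsub ⟨ε, hε, H⟩
      exact ⟨ε, hε, fun s hs => H s (hsub hs)⟩
    · intro s hs
      obtain ⟨ε, hε, hlt⟩ := exists_sq_lt_gaussianLaplace hW hpos hs.1 (hlap s hs.1)
      refine ⟨{r | r ^ 2 < (1 - ε) * (2 - ε) * gaussianLaplace W ε r},
        mem_nhdsWithin_of_mem_nhds ?_, ε, hε, fun _ h => h⟩
      exact (isOpen_lt (continuous_pow 2)
        (continuous_const.mul (continuous_gaussianLaplace hW hε.1))).mem_nhds hlt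
  obtain ⟨ε, hε, H⟩ := hunion _ (Ici S) hcompact ⟨1 / 2, by norm_num, fun s hs => hS s hs⟩
  have H0 : ∀ s, 0 ≤ s → s ^ 2 < (1 - ε) * (2 - ε) * gaussianLaplace W ε s := fun s hs =>
    H s ((le_total s S).imp (fun h => ⟨hs, h⟩) id)
  refine ⟨ε, hε, fun s => ?_⟩
  rcases le_total 0 s with hs | hs
  · exact H0 s hs
  · have := H0 (-s) (by linarith)
    rwa [gaussianLaplace_neg heven, neg_sq] at this

/-! ### The cut-off Gaussian and its second derivative. -/

theorem exists_bound_smoothTransition :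
    ∃ C : ℝ, 1 ≤ C ∧ ∀ x, |deriv Real.smoothTransition x| ≤ C ∧
      |deriv (deriv Real.smoothTransition) x| ≤ C := by
  have hd : ContDiff ℝ ∞ (deriv Real.smoothTransition) :=
    ContDiff.deriv' (n := ∞) (by simpa using Real.smoothTransition.contDiff (n := ⊤))
  have hloc : ∀ x ∉ Icc (0 : ℝ) 1, ∃ c : ℝ, Real.smoothTransition =ᶠ[𝓝 x] fun _ => c := by
    intro x hx
    rcases lt_or_ge x 0 with h | h
    · exact ⟨0, by filter_upwards [Iio_mem_nhds h] with y hy using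
        Real.smoothTransition.zero_of_nonpos (le_of_lt hy)⟩
    · have h1 : 1 < x := by
        by_contra h1
        exact hx ⟨h, not_lt.1 h1⟩
      exact ⟨1, by filter_upwards [Ioi_mem_nhds h1] with y hy using
        Real.smoothTransition.one_of_one_le (le_of_lt hy)⟩
  have h1 : ∀ x ∉ Icc (0 : ℝ) 1, deriv Real.smoothTransition x = 0 := by
    intro x hx
    obtain ⟨c, hc⟩ := hloc x hx
    rw [hc.deriv_eq, deriv_const]
  have h2 : ∀ x ∉ Icc (0 : ℝ) 1, deriv (deriv Real.smoothTransition) x = 0 := by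
    intro x hx
    obtain ⟨c, hc⟩ := hloc x hx
    rw [hc.deriv.deriv_eq]
    simp
  obtain ⟨C₁, hC₁⟩ := (HasCompactSupport.intro isCompact_Icc h1).exists_bound_of_continuous
    hd.continuous
  obtain ⟨C₂, hC₂⟩ := (HasCompactSupport.intro isCompact_Icc h2).exists_bound_of_continuous
    (hd.continuous_deriv (by simp))
  refine ⟨max 1 (max C₁ C₂), le_max_left _ _, fun x => ⟨?_, ?_⟩⟩
  · exact (hC₁ x).trans ((le_max_left _ _).trans (le_max_right _ _))
  · exact (hC₂ x).trans ((le_max_right _ _).trans (le_max_right _ _))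

/-- The Gaussian `exp (-ε t² / 2)`. -/
noncomputable def gaussianWeight (ε t : ℝ) : ℝ := Real.exp (-(ε * t ^ 2 / 2))

/-- A smooth cutoff equal to `1` on `[-(L-1), L-1]` and to `0` off `(-L, L)`. -/
noncomputable def plateau (L t : ℝ) : ℝ :=
  Real.smoothTransition (L - t) * Real.smoothTransition (L + t)

/-- The Gaussian `exp (-ε t² / 2)`, cut off to the interval `[-L, L]`. -/
noncomputable def cutoffGaussian (ε L t : ℝ) : ℝ := plateau L t * gaussianWeight ε t

theorem gaussianWeight_pos (ε t : ℝ) : 0 < gaussianWeight ε t := Real.exp_pos _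

theorem gaussianWeight_le {ε a t : ℝ} (hε : 0 ≤ ε) (ha : 0 ≤ a) (h : a ≤ |t|) :
    gaussianWeight ε t ≤ gaussianWeight ε a := by
  refine Real.exp_le_exp.2 ?_
  have : a ^ 2 ≤ t ^ 2 := by rw [← sq_abs t]; gcongr
  nlinarith

theorem plateau_nonneg (L t : ℝ) : 0 ≤ plateau L t :=
  mul_nonneg (Real.smoothTransition.nonneg _) (Real.smoothTransition.nonneg _)

theorem plateau_le_one (L t : ℝ) : plateau L t ≤ 1 :=
  mul_le_one₀ (Real.smoothTransition.le_one _) (Real.smoothTransition.nonneg _)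
    (Real.smoothTransition.le_one _)

theorem plateau_eq_one {L t : ℝ} (h : |t| ≤ L - 1) : plateau L t = 1 := by
  have := abs_le.1 h
  rw [plateau, Real.smoothTransition.one_of_one_le (by linarith),
    Real.smoothTransition.one_of_one_le (by linarith), one_mul]

theorem plateau_eq_zero {L t : ℝ} (h : L ≤ |t|) : plateau L t = 0 := by
  rcases le_abs.1 h with h | h
  · rw [plateau, Real.smoothTransition.zero_of_nonpos (by linarith), zero_mul]
  · rw [plateau, Real.smoothTransition.zero_of_nonpos (x := L + t) (by linarith), mul_zero]

theorem contDiff_cutoffGaussian (ε L : ℝ) : ContDiff ℝ ∞ (cutoffGaussian ε L) := by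
  have h : ContDiff ℝ ∞ Real.smoothTransition := Real.smoothTransition.contDiff (n := ⊤)
  have h1 : ContDiff ℝ ∞ fun t => Real.smoothTransition (L - t) := h.comp (by fun_prop)
  have h2 : ContDiff ℝ ∞ fun t => Real.smoothTransition (L + t) := h.comp (by fun_prop)
  have h3 : ContDiff ℝ ∞ fun t => Real.exp (-(ε * t ^ 2 / 2)) := by fun_prop
  exact (h1.mul h2).mul h3

theorem cutoffGaussian_nonneg (ε L t : ℝ) : 0 ≤ cutoffGaussian ε L t :=
  mul_nonneg (plateau_nonneg _ _) (gaussianWeight_pos _ _).le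

theorem cutoffGaussian_eq_zero {ε L t : ℝ} (h : L ≤ |t|) : cutoffGaussian ε L t = 0 := by
  rw [cutoffGaussian, plateau_eq_zero h, zero_mul]

/-- After subtraction of the value at the plateau edge, the left side is nonpositive off the
plateau. This allows the full Gaussian to be replaced by the cut-off one at a constant cost. -/
theorem gaussianWeight_sub_le_cutoffGaussian {ε L : ℝ} (hε : 0 ≤ ε) (hL : 1 ≤ L) (t : ℝ) :
    gaussianWeight ε t - gaussianWeight ε (L - 1) ≤ cutoffGaussian ε L t := by
  rcases le_total |t| (L - 1) with h | h
  · rw [cutoffGaussian, plateau_eq_one h, one_mul]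
    linarith [gaussianWeight_pos ε (L - 1)]
  · have := gaussianWeight_le hε (by linarith) h
    linarith [cutoffGaussian_nonneg ε L t]

theorem hasDerivAt_gaussianWeight (ε t : ℝ) :
    HasDerivAt (gaussianWeight ε) (-(ε * t) * gaussianWeight ε t) t := by
  have h : HasDerivAt (fun t : ℝ => -(ε * t ^ 2 / 2)) (-(ε * t)) t := by
    refine ((((hasDerivAt_pow 2 t).const_mul ε).div_const 2).neg).congr_deriv ?_
    simp; ring
  exact h.exp.congr_deriv (mul_comm _ _)

theorem deriv_deriv_gaussianWeight (ε t : ℝ) :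
    deriv (deriv (gaussianWeight ε)) t = gaussianWeight ε t * (ε ^ 2 * t ^ 2 - ε) := by
  have h1 : deriv (gaussianWeight ε) = fun t => -(ε * t) * gaussianWeight ε t :=
    funext fun t => (hasDerivAt_gaussianWeight ε t).deriv
  rw [h1]
  refine ((((hasDerivAt_id t).const_mul ε).neg).mul (hasDerivAt_gaussianWeight ε t)).deriv.trans ?_
  simp; ring

theorem deriv_deriv_cutoffGaussian {ε L t : ℝ} (h : |t| < L - 1) :
    deriv (deriv (cutoffGaussian ε L)) t = gaussianWeight ε t * (ε ^ 2 * t ^ 2 - ε) := by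
  have : cutoffGaussian ε L =ᶠ[𝓝 t] gaussianWeight ε := by
    filter_upwards [(isOpen_lt continuous_abs continuous_const).mem_nhds h] with x hx
    rw [cutoffGaussian, plateau_eq_one (le_of_lt hx), one_mul]
  rw [this.deriv.deriv_eq, deriv_deriv_gaussianWeight]

/-- In the transition layer every term of the product rule carries a Gaussian factor at most its
value at `L - 1`, and the logarithmic slope `ε t` is at most `L` in size. Only an upper bound is
needed, since it will be multiplied by `1 - v ≥ 0`. -/
theorem exists_bound_deriv_deriv_cutoffGaussian {ε : ℝ} (hε : ε ∈ Ioo (0 : ℝ) 1) :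
    ∃ C : ℝ, 0 ≤ C ∧ ∀ L t : ℝ, 1 ≤ L → |t| ≤ L → L - 1 ≤ |t| →
      deriv (deriv (cutoffGaussian ε L)) t ≤ C * (1 + L) ^ 2 * gaussianWeight ε (L - 1) := by
  obtain ⟨C, hC1, hC⟩ := exists_bound_smoothTransition
  have hd : ContDiff ℝ ∞ (deriv Real.smoothTransition) :=
    ContDiff.deriv' (n := ∞) (by simpa using Real.smoothTransition.contDiff (n := ⊤))
  have hχ : ∀ x, HasDerivAt Real.smoothTransition (deriv Real.smoothTransition x) x := fun x =>
    ((Real.smoothTransition.contDiff (n := ⊤)).differentiable (by simp)).differentiableAt.hasDerivAt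
  have hχ' : ∀ x, HasDerivAt (deriv Real.smoothTransition)
      (deriv (deriv Real.smoothTransition) x) x := fun x =>
    (hd.differentiable (by simp)).differentiableAt.hasDerivAt
  refine ⟨12 * C ^ 2, by positivity, fun L t hL ht hLt => ?_⟩
  set χ := Real.smoothTransition
  have hg := hasDerivAt_gaussianWeight ε
  have hm : ∀ t, HasDerivAt (fun t => L - t) (-1) t := fun t => (hasDerivAt_id t).const_sub L
  have hp : ∀ t, HasDerivAt (fun t => L + t) 1 t := fun t => (hasDerivAt_id t).const_add L
  have hχm : ∀ t, HasDerivAt (fun t => χ (L - t)) (deriv χ (L - t) * -1) t := fun t =>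
    (hχ (L - t)).comp t (hm t)
  have hχp : ∀ t, HasDerivAt (fun t => χ (L + t)) (deriv χ (L + t) * 1) t := fun t =>
    (hχ (L + t)).comp t (hp t)
  have hχm' : ∀ t, HasDerivAt (fun t => deriv χ (L - t)) (deriv (deriv χ) (L - t) * -1) t :=
    fun t => (hχ' (L - t)).comp t (hm t)
  have hχp' : ∀ t, HasDerivAt (fun t => deriv χ (L + t)) (deriv (deriv χ) (L + t) * 1) t :=
    fun t => (hχ' (L + t)).comp t (hp t)
  have h1 : deriv (cutoffGaussian ε L) = fun t =>
      (deriv χ (L - t) * -1 * χ (L + t) + χ (L - t) * (deriv χ (L + t) * 1)) * gaussianWeight ε t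
        + χ (L - t) * χ (L + t) * (-(ε * t) * gaussianWeight ε t) :=
    funext fun t => (((hχm t).mul (hχp t)).mul (hg t)).deriv
  rw [h1]
  refine (((((((hχm' t).mul_const (-1)).mul (hχp t)).add
    ((hχm t).mul ((hχp' t).mul_const 1))).mul (hg t)).add (((hχm t).mul (hχp t)).mul
    ((((hasDerivAt_id t).const_mul ε).neg).mul (hg t)))).deriv).le.trans ?_
  simp only [id, Pi.mul_apply, Pi.add_apply, Pi.neg_apply]
  have ha0 := Real.smoothTransition.nonneg (L - t)
  have ha1 := Real.smoothTransition.le_one (L - t)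
  have hb0 := Real.smoothTransition.nonneg (L + t)
  have hb1 := Real.smoothTransition.le_one (L + t)
  obtain ⟨ha', ha''⟩ := hC (L - t)
  obtain ⟨hb', hb''⟩ := hC (L + t)
  have hw := gaussianWeight_pos ε t
  have hwle := gaussianWeight_le hε.1.le (by linarith) hLt
  generalize gaussianWeight ε t = w at *
  change |deriv χ (L - t)| ≤ C at ha'
  change |deriv χ (L + t)| ≤ C at hb'
  change |deriv (deriv χ) (L - t)| ≤ C at ha''
  change |deriv (deriv χ) (L + t)| ≤ C at hb''
  change 0 ≤ χ (L - t) at ha0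
  change χ (L - t) ≤ 1 at ha1
  change 0 ≤ χ (L + t) at hb0
  change χ (L + t) ≤ 1 at hb1
  generalize deriv (deriv χ) (L - t) = a2 at *
  generalize deriv (deriv χ) (L + t) = b2 at *
  generalize deriv χ (L - t) = a1 at *
  generalize deriv χ (L + t) = b1 at *
  generalize χ (L - t) = a at *
  generalize χ (L + t) = b at *
  have hr : |ε * t| ≤ L := by
    rw [abs_mul, abs_of_pos hε.1]
    nlinarith [hε.1, hε.2, abs_nonneg t]
  have e1 : |a2 * b| ≤ C := by
    rw [abs_mul, abs_of_nonneg hb0]; nlinarith [abs_nonneg a2]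
  have e2 : |a * b2| ≤ C := by
    rw [abs_mul, abs_of_nonneg ha0]; nlinarith [abs_nonneg b2]
  have e3 : |a1 * b1| ≤ C ^ 2 := by
    rw [abs_mul, sq]; exact mul_le_mul ha' hb' (abs_nonneg _) (by linarith)
  have e4 : |a1 * b * (ε * t)| ≤ C * L := by
    rw [abs_mul]
    refine mul_le_mul ?_ hr (abs_nonneg _) (by linarith)
    rw [abs_mul, abs_of_nonneg hb0]; nlinarith [abs_nonneg a1]
  have e5 : |a * b1 * (ε * t)| ≤ C * L := by
    rw [abs_mul]
    refine mul_le_mul ?_ hr (abs_nonneg _) (by linarith)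
    rw [abs_mul, abs_of_nonneg ha0]; nlinarith [abs_nonneg b1]
  have e6 : a * b * (ε * t) ^ 2 ≤ L ^ 2 := by
    have h2 : (ε * t) ^ 2 ≤ L ^ 2 := sq_le_sq' (by linarith [neg_abs_le (ε * t)])
      (by linarith [le_abs_self (ε * t)])
    have h3 : a * b ≤ 1 := mul_le_one₀ ha1 hb0 hb1
    nlinarith [sq_nonneg (ε * t)]
  have e7 : 0 ≤ a * b * ε := mul_nonneg (mul_nonneg ha0 hb0) hε.1.le
  have hsum : a2 * b - 2 * (a1 * b1) + a * b2 + 2 * (a1 * b * (ε * t)) - 2 * (a * b1 * (ε * t))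
      + a * b * (ε * t) ^ 2 - a * b * ε ≤ 12 * C ^ 2 * (1 + L) ^ 2 := by
    have := abs_le.1 e1
    have := abs_le.1 e2
    have := abs_le.1 e3
    have := abs_le.1 e4
    have := abs_le.1 e5
    have : C ≤ C ^ 2 := by nlinarith
    have : C * L ≤ C ^ 2 * L := by nlinarith
    have : L ^ 2 ≤ C ^ 2 * L ^ 2 := by nlinarith [sq_nonneg L]
    nlinarith [mul_nonneg (sq_nonneg C) (by linarith : 0 ≤ L), mul_nonneg (sq_nonneg C) (sq_nonneg L)]
  calc _ = w * (a2 * b - 2 * (a1 * b1) + a * b2 + 2 * (a1 * b * (ε * t))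
        - 2 * (a * b1 * (ε * t)) + a * b * (ε * t) ^ 2 - a * b * ε) := by ring
    _ ≤ w * (12 * C ^ 2 * (1 + L) ^ 2) := mul_le_mul_of_nonneg_left hsum hw.le
    _ ≤ _ := by
      rw [mul_comm]
      exact mul_le_mul_of_nonneg_left hwle (by positivity)

/-! ### Monotone profiles and the weak equation for `1 - v`. -/

/-- The convolution `W * (1 - v²)` for a real profile `v`. -/
noncomputable def nonlocalDensity (W v : ℝ → ℝ) (x : ℝ) : ℝ := ∫ t, W t * (1 - v (x - t) ^ 2)

/-- The correlation of `W` with `φ`. -/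
noncomputable def correlation (W φ : ℝ → ℝ) (y : ℝ) : ℝ := ∫ t, W t * φ (y + t)

/-- A nondecreasing real profile joining `-1` to `1` and solving `v'' + v (W * (1 - v²)) = 0`
in the sense of distributions. -/
structure MonotoneProfile (W v : ℝ → ℝ) : Prop where
  monotone : Monotone v
  tendsto_atTop : Tendsto v atTop (𝓝 1)
  tendsto_atBot : Tendsto v atBot (𝓝 (-1))
  equation : ∀ φ : ℝ → ℝ, ContDiff ℝ ∞ φ → HasCompactSupport φ →
    ∫ x, (iteratedDeriv 2 φ x * v x + φ x * nonlocalDensity W v x * v x) = 0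

theorem exists_mem_Ioo_of_ae {p : ℝ → Prop} (h : ∀ᵐ x, p x) {a b : ℝ} (hab : a < b) :
    ∃ x ∈ Ioo a b, p x := by
  obtain ⟨x, hx, hp⟩ := (Measure.dense_of_ae h).exists_between hab
  exact ⟨x, hp, hx⟩

/-- Equality holds only a.e., but monotonicity traps `v x` between values at nearby points where `u
= v`. -/
theorem tendsto_atTop_of_ae_eq {u : ℝ → ℂ} {v : ℝ → ℝ} (hv : Monotone v)
    (huv : ∀ᵐ x, u x = (v x : ℂ)) {l : ℝ} (hu : Tendsto u atTop (𝓝 (l : ℂ))) :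
    Tendsto v atTop (𝓝 l) := by
  have hre : Tendsto (fun x => (u x).re) atTop (𝓝 l) := by
    simpa [Function.comp_def] using (Complex.continuous_re.tendsto _).comp hu
  refine tendsto_order.2 ⟨fun a ha => ?_, fun a ha => ?_⟩
  · obtain ⟨B, hB⟩ := eventually_atTop.1 (hre.eventually_const_lt ha)
    filter_upwards [eventually_ge_atTop (B + 1)] with x hx
    obtain ⟨y, hy, hyu⟩ := exists_mem_Ioo_of_ae huv (lt_add_one B)
    have h1 := hB y hy.1.le
    rw [hyu, Complex.ofReal_re] at h1
    exact h1.trans_le (hv (hy.2.le.trans hx))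
  · obtain ⟨B, hB⟩ := eventually_atTop.1 (hre.eventually_lt_const ha)
    filter_upwards [eventually_ge_atTop B] with x hx
    obtain ⟨y, hy, hyu⟩ := exists_mem_Ioo_of_ae huv (lt_add_one x)
    have h1 := hB y (hx.trans hy.1.le)
    rw [hyu, Complex.ofReal_re] at h1
    exact (hv hy.1.le).trans_lt h1

theorem tendsto_atBot_of_ae_eq {u : ℝ → ℂ} {v : ℝ → ℝ} (hv : Monotone v)
    (huv : ∀ᵐ x, u x = (v x : ℂ)) {l : ℝ} (hu : Tendsto u atBot (𝓝 (l : ℂ))) :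
    Tendsto v atBot (𝓝 l) := by
  have hre : Tendsto (fun x => (u x).re) atBot (𝓝 l) := by
    simpa [Function.comp_def] using (Complex.continuous_re.tendsto _).comp hu
  refine tendsto_order.2 ⟨fun a ha => ?_, fun a ha => ?_⟩
  · obtain ⟨B, hB⟩ := eventually_atBot.1 (hre.eventually_const_lt ha)
    filter_upwards [eventually_le_atBot B] with x hx
    obtain ⟨y, hy, hyu⟩ := exists_mem_Ioo_of_ae huv (sub_one_lt x)
    have h1 := hB y (hy.2.le.trans hx)
    rw [hyu, Complex.ofReal_re] at h1
    exact h1.trans_le (hv hy.2.le)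
  · obtain ⟨B, hB⟩ := eventually_atBot.1 (hre.eventually_lt_const ha)
    filter_upwards [eventually_le_atBot (B - 1)] with x hx
    obtain ⟨y, hy, hyu⟩ := exists_mem_Ioo_of_ae huv (sub_one_lt B)
    have h1 := hB y hy.2.le
    rw [hyu, Complex.ofReal_re] at h1
    exact (hv (hx.trans hy.1.le)).trans_lt h1

theorem nonlocalTerm_eq_nonlocalDensity {W : ℝ → ℝ} {u : ℝ → ℂ} {v : ℝ → ℝ}
    (huv : ∀ᵐ x, u x = (v x : ℂ)) (x : ℝ) : nonlocalTerm W u x = nonlocalDensity W v x := by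
  refine integral_congr_ae ?_
  have hq : ∀ᵐ t, u (x - t) = (v (x - t) : ℂ) :=
    (Measure.measurePreserving_sub_left volume x).quasiMeasurePreserving.ae huv
  filter_upwards [hq] with t ht
  simp [ht]

theorem MonotoneProfile.of_isStaticSolution {W : ℝ → ℝ} {u : ℝ → ℂ} {v : ℝ → ℝ}
    (hv : Monotone v) (huv : ∀ᵐ x, u x = (v x : ℂ)) (hu_sol : IsStaticSolution W u)
    (hu_top : Tendsto u atTop (𝓝 1)) (hu_bot : Tendsto u atBot (𝓝 (-1))) :
    MonotoneProfile W v where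
  monotone := hv
  tendsto_atTop := tendsto_atTop_of_ae_eq hv huv (by simpa using hu_top)
  tendsto_atBot := tendsto_atBot_of_ae_eq hv huv (by simpa using hu_bot)
  equation φ hφ hφc := by
    rw [← Complex.ofReal_inj, ← integral_complex_ofReal, Complex.ofReal_zero, ← hu_sol φ hφ hφc]
    refine integral_congr_ae ?_
    filter_upwards [huv] with x hx
    rw [hx, nonlocalTerm_eq_nonlocalDensity huv]
    simp

namespace MonotoneProfile

variable {W v φ : ℝ → ℝ}

theorem le_one (h : MonotoneProfile W v) (x : ℝ) : v x ≤ 1 := h.monotone.ge_of_tendsto h.tendsto_atTop x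

theorem neg_one_le (h : MonotoneProfile W v) (x : ℝ) : -1 ≤ v x :=
  h.monotone.le_of_tendsto h.tendsto_atBot x

theorem abs_le_one (h : MonotoneProfile W v) (x : ℝ) : ‖v x‖ ≤ 1 :=
  abs_le.2 ⟨h.neg_one_le x, h.le_one x⟩

theorem density_nonneg (h : MonotoneProfile W v) (x : ℝ) : 0 ≤ 1 - v x ^ 2 := by
  nlinarith [h.le_one x, h.neg_one_le x]

theorem norm_density_le_one (h : MonotoneProfile W v) (x : ℝ) : ‖1 - v x ^ 2‖ ≤ 1 := by
  rw [Real.norm_of_nonneg (h.density_nonneg x)]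
  nlinarith [sq_nonneg (v x)]

theorem measurable (h : MonotoneProfile W v) : Measurable v := h.monotone.measurable

theorem integrable_prod (h : MonotoneProfile W v) (hW : Integrable W) (hφ : Integrable φ) :
    Integrable (fun p : ℝ × ℝ => φ p.1 * W p.2 * (1 - v (p.1 - p.2) ^ 2)) (volume.prod volume) := by
  refine (hφ.mul_prod hW).mul_bdd (c := 1) ?_ (Eventually.of_forall fun p => h.norm_density_le_one _)
  have := h.measurable
  exact (by fun_prop : Measurable fun p : ℝ × ℝ => 1 - v (p.1 - p.2) ^ 2).aestronglyMeasurable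

theorem integrable_mul_nonlocalDensity (h : MonotoneProfile W v) (hW : Integrable W)
    (hφ : Integrable φ) : Integrable fun x => φ x * nonlocalDensity W v x := by
  refine (h.integrable_prod hW hφ).integral_prod_left.congr (Eventually.of_forall fun x => ?_)
  simp only [nonlocalDensity, mul_assoc, integral_const_mul]

theorem integrable_prod_shift (h : MonotoneProfile W v) (hW : Integrable W) (hφ : Integrable φ) :
    Integrable (fun p : ℝ × ℝ => φ (p.1 + p.2) * W p.2 * (1 - v p.1 ^ 2))
      (volume.prod volume) := by
  have hmp : MeasurePreserving (fun p : ℝ × ℝ => (p.1 + p.2, p.2))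
      (volume.prod volume) (volume.prod volume) := measurePreserving_add_prod _ _
  have := hmp.integrable_comp_of_integrable (h.integrable_prod hW hφ)
  simpa [Function.comp_def] using this

/-- Fubini moves `W` onto the test function: correlation is the adjoint of convolution. -/
theorem integral_mul_nonlocalDensity (h : MonotoneProfile W v) (hW : Integrable W)
    (hφ : Integrable φ) :
    ∫ x, φ x * nonlocalDensity W v x = ∫ y, (1 - v y ^ 2) * correlation W φ y := by
  calc ∫ x, φ x * nonlocalDensity W v x
      = ∫ x, ∫ t, φ x * W t * (1 - v (x - t) ^ 2) := by
        simp only [nonlocalDensity, mul_assoc, integral_const_mul]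
    _ = ∫ t, ∫ x, φ x * W t * (1 - v (x - t) ^ 2) := integral_integral_swap (h.integrable_prod hW hφ)
    _ = ∫ t, ∫ y, φ (y + t) * W t * (1 - v y ^ 2) := by
        refine integral_congr_ae (Eventually.of_forall fun t => ?_)
        simp only
        rw [← integral_add_right_eq_self _ t]
        simp
    _ = ∫ y, ∫ t, φ (y + t) * W t * (1 - v y ^ 2) :=
        (integral_integral_swap (h.integrable_prod_shift hW hφ)).symm
    _ = _ := by
        refine integral_congr_ae (Eventually.of_forall fun y => ?_)
        simp only [correlation, ← integral_const_mul]
        refine integral_congr_ae (Eventually.of_forall fun t => ?_)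
        simp only; ring

theorem integrable_mul_correlation (h : MonotoneProfile W v) (hW : Integrable W)
    (hφ : Integrable φ) : Integrable fun y => (1 - v y ^ 2) * correlation W φ y := by
  refine (h.integrable_prod_shift hW hφ).integral_prod_left.congr (Eventually.of_forall fun y => ?_)
  simp only [correlation, ← integral_const_mul]
  refine integral_congr_ae (Eventually.of_forall fun t => ?_)
  simp only; ring

theorem integrable_mul_self (h : MonotoneProfile W v) {f : ℝ → ℝ} (hf : Integrable f) :
    Integrable fun x => f x * v x :=
  hf.mul_bdd (c := 1) h.measurable.aestronglyMeasurable (Eventually.of_forall h.abs_le_one)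

end MonotoneProfile

theorem integrable_iteratedDeriv {φ : ℝ → ℝ} (hφ : ContDiff ℝ ∞ φ) (hφc : HasCompactSupport φ)
    (n : ℕ) : Integrable (iteratedDeriv n φ) := by
  refine (hφ.continuous_iteratedDeriv n (by exact_mod_cast le_top)).integrable_of_hasCompactSupport ?_
  induction n with
  | zero => simpa
  | succ n ih => rw [iteratedDeriv_succ]; exact ih.deriv

theorem hasDerivAt_iteratedDeriv {φ : ℝ → ℝ} (hφ : ContDiff ℝ ∞ φ) (n : ℕ) (x : ℝ) :
    HasDerivAt (iteratedDeriv n φ) (iteratedDeriv (n + 1) φ x) x := by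
  rw [iteratedDeriv_succ]
  exact (hφ.differentiable_iteratedDeriv n (by exact_mod_cast ENat.natCast_lt_top n)).differentiableAt.hasDerivAt

theorem integral_iteratedDeriv_two {φ : ℝ → ℝ} (hφ : ContDiff ℝ ∞ φ) (hφc : HasCompactSupport φ) :
    ∫ x, iteratedDeriv 2 φ x = 0 :=
  integral_eq_zero_of_hasDerivAt_of_integrable (hasDerivAt_iteratedDeriv hφ 1)
    (integrable_iteratedDeriv hφ hφc 2) (integrable_iteratedDeriv hφ hφc 1)

theorem correlation_nonneg {W φ : ℝ → ℝ} (hpos : ∀ᵐ x, 0 ≤ W x) (hφ : ∀ x, 0 ≤ φ x) (y : ℝ) :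
    0 ≤ correlation W φ y := by
  refine integral_nonneg_of_ae ?_
  filter_upwards [hpos] with t ht using mul_nonneg ht (hφ _)

namespace MonotoneProfile

variable {W v φ : ℝ → ℝ}

theorem integral_iteratedDeriv_mul_one_sub (h : MonotoneProfile W v) (hW : Integrable W)
    (hφ : ContDiff ℝ ∞ φ) (hφc : HasCompactSupport φ) :
    ∫ x, iteratedDeriv 2 φ x * (1 - v x) = ∫ x, φ x * nonlocalDensity W v x * v x := by
  have hφi : Integrable φ := hφ.continuous.integrable_of_hasCompactSupport hφc
  have h2 := integrable_iteratedDeriv hφ hφc 2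
  have heq := h.equation φ hφ hφc
  rw [integral_add (h.integrable_mul_self h2)
    (h.integrable_mul_self (h.integrable_mul_nonlocalDensity hW hφi))] at heq
  simp only [mul_sub, mul_one]
  rw [integral_sub h2 (h.integrable_mul_self h2), integral_iteratedDeriv_two hφ hφc]
  linarith

theorem nonlocalDensity_nonneg (h : MonotoneProfile W v) (hpos : ∀ᵐ x, 0 ≤ W x) (x : ℝ) :
    0 ≤ nonlocalDensity W v x := by
  refine integral_nonneg_of_ae ?_
  filter_upwards [hpos] with t ht using mul_nonneg ht (h.density_nonneg _)

/-- The tested form of `(1 - v)'' ≥ c W * (1 - v²)` where `v ≥ c`; it uses that the nonlocal term is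
nonnegative. -/
theorem le_integral_iteratedDeriv_mul_one_sub (h : MonotoneProfile W v) (hW : Integrable W)
    (hpos : ∀ᵐ x, 0 ≤ W x) (hφ : ContDiff ℝ ∞ φ) (hφc : HasCompactSupport φ) (hφ0 : ∀ x, 0 ≤ φ x)
    {c : ℝ} (hc : ∀ x, φ x ≠ 0 → c ≤ v x) :
    c * ∫ y, (1 - v y ^ 2) * correlation W φ y ≤ ∫ x, iteratedDeriv 2 φ x * (1 - v x) := by
  have hφi : Integrable φ := hφ.continuous.integrable_of_hasCompactSupport hφc
  have hi := h.integrable_mul_nonlocalDensity hW hφi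
  rw [h.integral_iteratedDeriv_mul_one_sub hW hφ hφc, ← h.integral_mul_nonlocalDensity hW hφi,
    ← integral_const_mul]
  refine integral_mono (hi.const_mul c) (h.integrable_mul_self hi) fun x => ?_
  simp only
  rcases eq_or_ne (φ x) 0 with h0 | h0
  · simp [h0]
  · rw [mul_comm]
    exact mul_le_mul_of_nonneg_left (hc x h0)
      (mul_nonneg (hφ0 x) (h.nonlocalDensity_nonneg hpos x))

end MonotoneProfile

/-! ### The profile never reaches `1`. -/

theorem mul_integral_le_correlation {W φ : ℝ → ℝ} (hW : Integrable W) (hpos : ∀ᵐ x, 0 ≤ W x)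
    (hφ : Continuous φ) (hφc : HasCompactSupport φ) (hφ0 : ∀ x, 0 ≤ φ x)
    {τ σ : ℝ} (hlower : ∀ᵐ x, x ∈ Ioo (-τ) τ → σ ≤ W x) {y : ℝ}
    (hsupp : ∀ x, φ x ≠ 0 → x - y ∈ Ioo (-τ) τ) :
    σ * ∫ x, φ x ≤ correlation W φ y := by
  obtain ⟨C, hC⟩ := hφc.exists_bound_of_continuous hφ
  have hi : Integrable φ := hφ.integrable_of_hasCompactSupport hφc
  rw [← integral_add_left_eq_self φ y, ← integral_const_mul]
  refine integral_mono_ae ((hi.comp_add_left y).const_mul σ)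
    (hW.mul_bdd (c := C) (by fun_prop) (Eventually.of_forall fun t => hC _)) ?_
  filter_upwards [hpos, hlower] with t h0 h1
  rcases eq_or_ne (φ (y + t)) 0 with hz | hz
  · simp [hz]
  · exact mul_le_mul_of_nonneg_right (h1 (by simpa using hsupp _ hz)) (hφ0 _)

namespace MonotoneProfile

variable {W v : ℝ → ℝ}

/-- A profile which equals `1` to the right of `x₀` and is less than `1` to the left of `x₀`
equals `-1` to the left of `x₀`. -/
theorem eq_neg_one_of_lt (h : MonotoneProfile W v) (hW : Integrable W) (hpos : ∀ᵐ x, 0 ≤ W x)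
    {τ σ : ℝ} (hτ : 0 < τ) (hσ : 0 < σ) (hlower : ∀ᵐ x, x ∈ Ioo (-τ) τ → σ ≤ W x)
    {x₀ : ℝ} (hright : ∀ x, x₀ < x → v x = 1) (hleft : ∀ x, x < x₀ → v x < 1)
    {z : ℝ} (hz : z < x₀) : v z = -1 := by
  -- The bump lives in `(x₀, x₀ + τ/2)`, where `v = 1`, so testing forces `(1 - v²) · correlation W
  -- b` to vanish a.e. Points of `(x₀ - τ/4, x₀)` lie within `3τ/4 < τ` of the support, so the
  -- correlation is positive there and `v² = 1`.
  let b : ContDiffBump (x₀ + τ / 4) := ⟨τ / 8, τ / 4, by positivity, by linarith⟩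
  have hb0 : ∀ x, b x ≠ 0 → x ∈ Ioo x₀ (x₀ + τ / 2) := by
    intro x hx
    have : x ∈ Function.support b := hx
    rw [b.support_eq, Real.ball_eq_Ioo] at this
    have hr : b.rOut = τ / 4 := rfl
    rw [hr] at this
    exact ⟨by linarith [this.1], by linarith [this.2]⟩
  have hbi : Integrable b := b.continuous.integrable_of_hasCompactSupport b.hasCompactSupport
  have hle := h.le_integral_iteratedDeriv_mul_one_sub hW hpos b.contDiff b.hasCompactSupport
    (fun x => b.nonneg) (c := 1) fun x hx => (hright x (hb0 x hx).1).ge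
  have hzero : ∫ x, iteratedDeriv 2 b x * (1 - v x) = 0 := by
    refine integral_eq_zero_of_ae ?_
    filter_upwards [compl_mem_ae_iff.2 (measure_singleton x₀)] with x hx
    rcases lt_or_gt_of_ne hx with hlt | hlt
    · have : b =ᶠ[𝓝 x] fun _ => (0 : ℝ) := by
        filter_upwards [Iio_mem_nhds hlt] with w hw
        by_contra hne
        exact absurd (hb0 w hne).1 (not_lt.2 (le_of_lt hw))
      simp [this.iteratedDeriv_eq 2]
    · simp [hright x hlt]
  have hnn : ∀ y, 0 ≤ (1 - v y ^ 2) * correlation W b y := fun y =>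
    mul_nonneg (h.density_nonneg y) (correlation_nonneg hpos (fun x => b.nonneg) y)
  rw [hzero, one_mul] at hle
  have hae := (integral_eq_zero_iff_of_nonneg hnn (h.integrable_mul_correlation hW hbi)).1
    (le_antisymm hle (integral_nonneg hnn))
  obtain ⟨y, hy, hy0⟩ := exists_mem_Ioo_of_ae hae
    (max_lt hz (by linarith) : max z (x₀ - τ / 4) < x₀)
  have hzy := (le_max_left _ _).trans_lt hy.1
  have hτy := (le_max_right _ _).trans_lt hy.1
  have hcorr := mul_integral_le_correlation hW hpos b.continuous b.hasCompactSupport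
    (fun x => b.nonneg) hlower (y := y) fun x hx => by
      have := hb0 x hx
      exact ⟨by linarith [this.1, hy.2], by linarith [this.2]⟩
  have hpos' : 0 < correlation W b y := (mul_pos hσ (b.integral_pos)).trans_le hcorr
  have hv : 1 - v y ^ 2 = 0 := (mul_eq_zero.1 hy0).resolve_right hpos'.ne'
  have : v y ≤ -1 := by nlinarith [hleft y hy.2]
  exact le_antisymm ((h.monotone hzy.le).trans this) (h.neg_one_le z)

/-- Otherwise `v` jumps from `-1` to `1` at the first point `x₀` where it reaches `1`. The nonlocal
term of such a step vanishes, so the equation reduces to `v'' = 0`, which a jump violates. -/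
theorem lt_one (h : MonotoneProfile W v) (hW : Integrable W) (hpos : ∀ᵐ x, 0 ≤ W x)
    {τ σ : ℝ} (hτ : 0 < τ) (hσ : 0 < σ) (hlower : ∀ᵐ x, x ∈ Ioo (-τ) τ → σ ≤ W x) (x : ℝ) :
    v x < 1 := by
  by_contra hcon
  set S : Set ℝ := {x | 1 ≤ v x} with hS
  have hne : S.Nonempty := ⟨x, not_lt.1 hcon⟩
  obtain ⟨B, hB⟩ := eventually_atBot.1
    (h.tendsto_atBot.eventually_lt_const (by norm_num : (-1 : ℝ) < 1))
  have hbdd : BddBelow S := ⟨B, fun y hy => by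
    by_contra hlt
    exact absurd (hB y (not_le.1 hlt).le) (not_lt.2 hy)⟩
  set x₀ := sInf S with hx₀
  have hright : ∀ x, x₀ < x → v x = 1 := fun x hx => by
    obtain ⟨y, hy, hyx⟩ := exists_lt_of_csInf_lt hne hx
    exact le_antisymm (h.le_one x) (le_trans hy (h.monotone hyx.le))
  have hleft : ∀ x, x < x₀ → v x < 1 := fun x hx => by
    by_contra hlt
    exact absurd (csInf_le hbdd (not_lt.1 hlt)) (not_le.2 hx)
  have hneg : ∀ x, x < x₀ → v x = -1 := fun x hx =>
    h.eq_neg_one_of_lt hW hpos hτ hσ hlower hright hleft hx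
  have hdens : ∀ᵐ x, 1 - v x ^ 2 = 0 := by
    filter_upwards [compl_mem_ae_iff.2 (measure_singleton x₀)] with x hx
    rcases lt_or_gt_of_ne hx with hlt | hlt
    · rw [hneg x hlt]; norm_num
    · rw [hright x hlt]; norm_num
  have hN : ∀ x, nonlocalDensity W v x = 0 := fun x => by
    refine integral_eq_zero_of_ae ?_
    filter_upwards [(Measure.measurePreserving_sub_left volume x).quasiMeasurePreserving.ae hdens]
      with t ht
    simp [ht]
  let b : ContDiffBump (0 : ℝ) := ⟨1, 2, one_pos, one_lt_two⟩
  -- A test function with slope 1 at the jump: `∫ φ'' (1 - v) = 2 φ'(x₀) = 2`, while the equation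
  -- gives 0.
  set φ : ℝ → ℝ := fun x => (x - x₀) * b (x - x₀) with hφ
  have hbs : ContDiff ℝ ∞ fun x => b (x - x₀) := b.contDiff.comp (by fun_prop)
  have hφs : ContDiff ℝ ∞ φ := ContDiff.mul (by fun_prop) hbs
  have hφc : HasCompactSupport φ := by
    refine HasCompactSupport.mul_left (f := fun x => x - x₀) (f' := fun x => b (x - x₀)) ?_
    simpa [sub_eq_add_neg, Function.comp_def] using b.hasCompactSupport.comp_homeomorph (Homeomorph.addRight (-x₀))
  have hmain := h.integral_iteratedDeriv_mul_one_sub hW hφs hφc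
  simp only [hN, mul_zero, zero_mul, integral_zero] at hmain
  have hderiv : deriv φ x₀ = 1 := by
    have : φ =ᶠ[𝓝 x₀] fun x => x - x₀ := by
      filter_upwards [Metric.ball_mem_nhds x₀ one_pos] with x hx
      have hx' : x - x₀ ∈ Metric.closedBall (0 : ℝ) b.rIn := by
        rw [Metric.mem_ball, Real.dist_eq] at hx
        simpa using hx.le
      simp [hφ, b.one_of_mem_closedBall hx']
    rw [this.deriv_eq]
    simp
  have h1c : HasCompactSupport (iteratedDeriv 1 φ) := by
    rw [iteratedDeriv_one]; exact hφc.deriv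
  have hint : ∫ x in Iic x₀, iteratedDeriv 2 φ x = 1 := by
    rw [integral_Iic_of_hasDerivAt_of_tendsto' (f := iteratedDeriv 1 φ) (m := 0)
      (fun x _ => hasDerivAt_iteratedDeriv hφs 1 x)
      (integrable_iteratedDeriv hφs hφc 2).integrableOn ?_, iteratedDeriv_one, hderiv, sub_zero]
    exact h1c.is_zero_at_infty.mono_left atBot_le_cocompact
  have : ∫ x, iteratedDeriv 2 φ x * (1 - v x) = 2 * ∫ x in Iic x₀, iteratedDeriv 2 φ x := by
    rw [← integral_const_mul, ← integral_indicator measurableSet_Iic]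
    refine integral_congr_ae ?_
    filter_upwards [compl_mem_ae_iff.2 (measure_singleton x₀)] with x hx
    rcases lt_or_gt_of_ne hx with hlt | hlt
    · rw [indicator_of_mem (mem_Iic.2 hlt.le), hneg x hlt]; ring
    · rw [indicator_of_notMem (by simpa using hlt), hright x hlt]; ring
  rw [this, hint] at hmain
  norm_num at hmain

end MonotoneProfile

/-! ### Testing with the Gaussian, and the contradiction. -/

theorem integrable_mul_gaussianWeight_add {W : ℝ → ℝ} (hW : Integrable W) {ε : ℝ} (hε : 0 < ε)
    (y : ℝ) : Integrable fun t => W t * gaussianWeight ε (y + t) := by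
  refine hW.mul_bdd (c := 1) (by unfold gaussianWeight; fun_prop) (Eventually.of_forall fun t => ?_)
  rw [Real.norm_of_nonneg (gaussianWeight_pos _ _).le]
  exact Real.exp_le_one_iff.2 (by nlinarith [mul_nonneg hε.le (sq_nonneg (y + t))])

/-- Expanding `(y + t)²` leaves a cross term `-ε y t`, so the Laplace variable is the local slope `ε
y`. -/
theorem correlation_gaussianWeight (W : ℝ → ℝ) (ε y : ℝ) :
    correlation W (gaussianWeight ε) y = gaussianWeight ε y * gaussianLaplace W ε (ε * y) := by
  simp only [correlation, gaussianLaplace, ← integral_const_mul]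
  refine integral_congr_ae (Eventually.of_forall fun t => ?_)
  simp only [gaussianWeight]
  rw [mul_left_comm, ← Real.exp_add]
  ring_nf

/-- Since `W` has mass one, the constant lost in the cutoff passes through the correlation
unchanged. -/
theorem le_correlation_cutoffGaussian {W : ℝ → ℝ} (hW : Integrable W) (hpos : ∀ᵐ x, 0 ≤ W x)
    (hmass : ∫ x, W x = 1) {ε L : ℝ} (hε : 0 < ε) (hL : 1 ≤ L) (X x : ℝ) :
    gaussianWeight ε (x - X) * gaussianLaplace W ε (ε * (x - X)) - gaussianWeight ε (L - 1) ≤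
      correlation W (fun z => cutoffGaussian ε L (z - X)) x := by
  have hi := integrable_mul_gaussianWeight_add hW hε (x - X)
  have hsub : gaussianWeight ε (x - X) * gaussianLaplace W ε (ε * (x - X))
      - gaussianWeight ε (L - 1)
      = ∫ t, W t * (gaussianWeight ε (x - X + t) - gaussianWeight ε (L - 1)) := by
    rw [← correlation_gaussianWeight, correlation]
    simp only [mul_sub (W _)]
    rw [integral_sub hi (hW.mul_const _), integral_mul_const, hmass, one_mul]
  have hcont : Continuous (cutoffGaussian ε L) := (contDiff_cutoffGaussian ε L).continuous
  rw [hsub]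
  refine integral_mono_ae ((hi.sub (hW.mul_const _)).congr
      (Eventually.of_forall fun t => (mul_sub _ _ _).symm))
    (hW.mul_bdd (c := 1) (by fun_prop) (Eventually.of_forall fun t => ?_)) ?_
  · rw [Real.norm_of_nonneg (cutoffGaussian_nonneg _ _ _)]
    refine mul_le_one₀ (plateau_le_one _ _) (gaussianWeight_pos _ _).le ?_
    exact Real.exp_le_one_iff.2 (by nlinarith [mul_nonneg hε.le (sq_nonneg (x + t - X))])
  · filter_upwards [hpos] with t ht
    refine mul_le_mul_of_nonneg_left ?_ ht
    rw [show x + t - X = x - X + t by ring]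
    exact gaussianWeight_sub_le_cutoffGaussian hε.le hL _

/-- Pointwise balance on the plateau, with `a = v x`, `A` the correlation, `G` the transform and `q`
the squared slope. As `1 - a² = (1 - a)(1 + a)` with `1 + a ≥ 2 - ε`, the nonlocal term absorbs `g
q`, leaving the gain `-ε g` and the cutoff error `2 g₁`. -/
theorem interior_bound {ε a A g g₁ G q : ℝ} (hε : ε ∈ Ioo (0 : ℝ) 1) (ha : 1 - ε ≤ a)
    (ha1 : a ≤ 1) (hA0 : 0 ≤ A) (hA : g * G - g₁ ≤ A) (hg : 0 < g) (hg₁ : 0 < g₁)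
    (hq : q < (1 - ε) * (2 - ε) * G) :
    g * (q - ε) * (1 - a) - (1 - ε) * ((1 - a ^ 2) * A) ≤ (1 - a) * (2 * g₁ - ε * g) := by
  have hε0 := hε.1
  have hε1 := hε.2
  have hw0 : 0 ≤ 1 - a := by linarith
  have hκ : 0 ≤ (1 - ε) * (2 - ε) := mul_nonneg (by linarith) (by linarith)
  have hκ2 : (1 - ε) * (2 - ε) ≤ 2 := by nlinarith
  have hlo : 0 ≤ (1 - ε) * (1 - a) * A * (1 + a - (2 - ε)) :=
    mul_nonneg (mul_nonneg (mul_nonneg (by linarith) hw0) hA0) (by linarith)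
  have e1 := mul_le_mul_of_nonneg_left hA hκ
  have e2 := mul_le_mul_of_nonneg_left hq.le hg.le
  have e3 := mul_le_mul_of_nonneg_right hκ2 hg₁.le
  have hkey : g * (q - ε) - (1 - ε) * (2 - ε) * A ≤ 2 * g₁ - ε * g := by linarith
  linarith [mul_le_mul_of_nonneg_left hkey hw0]

namespace MonotoneProfile

variable {W v : ℝ → ℝ}

/-- Testing the equation with a Gaussian cut off to `[M, M + 2 * L]`. -/
theorem mul_exp_le (h : MonotoneProfile W v) (hW : Integrable W) (hpos : ∀ᵐ x, 0 ≤ W x)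
    (hmass : ∫ x, W x = 1) {ε : ℝ} (hε : ε ∈ Ioo (0 : ℝ) 1)
    (hlap : ∀ s, s ^ 2 < (1 - ε) * (2 - ε) * gaussianLaplace W ε s)
    {M : ℝ} (hM : ∀ x, M ≤ x → 1 - ε ≤ v x) :
    ∃ C : ℝ, ∀ L : ℝ, 4 ≤ L →
      ε * (1 - v (M + 3)) * Real.exp (ε * (L - 3 / 2)) ≤ C * (1 + L) ^ 3 := by
  obtain ⟨C, hC0, hC⟩ := exists_bound_deriv_deriv_cutoffGaussian hε
  refine ⟨2 * (C + 2), fun L hL => ?_⟩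
  have hε0 := hε.1
  have hε1 := hε.2
  set X := M + L with hX
  set g := gaussianWeight ε with hg
  have hg0 : ∀ t, 0 < g t := gaussianWeight_pos ε
  set φ : ℝ → ℝ := fun x => cutoffGaussian ε L (x - X) with hφ
  have hφs : ContDiff ℝ ∞ φ := (contDiff_cutoffGaussian ε L).comp (by fun_prop)
  have hφ0 : ∀ x, 0 ≤ φ x := fun x => cutoffGaussian_nonneg _ _ _
  have hout : ∀ x ∉ Icc M (M + 2 * L), φ x = 0 := fun x hx => by
    refine cutoffGaussian_eq_zero ?_
    by_contra! hlt
    have := abs_lt.1 hlt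
    exact hx ⟨by linarith [this.1], by linarith [this.2]⟩
  have hφc : HasCompactSupport φ := HasCompactSupport.intro isCompact_Icc hout
  have hφi : Integrable φ := hφs.continuous.integrable_of_hasCompactSupport hφc
  have hφ2 : ∀ x, iteratedDeriv 2 φ x = deriv (deriv (cutoffGaussian ε L)) (x - X) := fun x => by
    rw [hφ, iteratedDeriv_comp_sub_const, iteratedDeriv_succ, iteratedDeriv_one]
  have hle := h.le_integral_iteratedDeriv_mul_one_sub hW hpos hφs hφc hφ0 (c := 1 - ε)
    fun x hx => hM x (by
      by_contra hlt
      exact hx (hout x fun hmem => hlt hmem.1))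
  have hcor0 : ∀ y, 0 ≤ correlation W φ y := correlation_nonneg hpos hφ0
  set D := (C + 2) * (1 + L) ^ 2 * g (L - 1) with hD
  set E := ε * (1 - v (M + 3)) * g (L - 2) with hE
  have hD2 : 2 * g (L - 1) ≤ D := by
    rw [hD]
    refine mul_le_mul_of_nonneg_right ?_ (hg0 _).le
    nlinarith [mul_nonneg hC0 (sq_nonneg (1 + L)), sq_nonneg L]
  have hDC : C * (1 + L) ^ 2 * g (L - 1) ≤ D := by
    rw [hD]
    refine mul_le_mul_of_nonneg_right ?_ (hg0 _).le
    nlinarith [sq_nonneg (1 + L)]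
  have hD0 : 0 ≤ D := (mul_pos two_pos (hg0 _)).le.trans hD2
  have hpt : ∀ x, iteratedDeriv 2 φ x * (1 - v x)
        - (1 - ε) * ((1 - v x ^ 2) * correlation W φ x) ≤
      (Icc M (M + 2 * L)).indicator (fun _ => D) x
        - (Icc (M + 2) (M + 3)).indicator (fun _ => E) x := by
    intro x
    have hw0 : 0 ≤ 1 - v x := by linarith [h.le_one x]
    have hnl : 0 ≤ (1 - ε) * ((1 - v x ^ 2) * correlation W φ x) :=
      mul_nonneg (by linarith) (mul_nonneg (h.density_nonneg x) (hcor0 x))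
    by_cases hx : x ∈ Icc M (M + 2 * L)
    · rw [indicator_of_mem hx]
      have hvx := hM x hx.1
      have hw1 : 1 - v x ≤ 1 := by linarith
      have habs : |x - X| ≤ L := abs_le.2 ⟨by linarith [hx.1], by linarith [hx.2]⟩
      rcases lt_or_ge |x - X| (L - 1) with hin | hedge
      · have hcor := le_correlation_cutoffGaussian hW hpos hmass hε0 (by linarith : 1 ≤ L) X x
        have hup := interior_bound hε hvx (h.le_one x) (hcor0 x) hcor (hg0 _) (hg0 _)
          (hlap (ε * (x - X)))
        rw [hφ2, deriv_deriv_cutoffGaussian hin, ← mul_pow]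
        refine hup.trans ?_
        have hg1 : (1 - v x) * (2 * g (L - 1)) ≤ D :=
          (mul_le_of_le_one_left (mul_pos two_pos (hg0 _)).le hw1).trans hD2
        by_cases hx' : x ∈ Icc (M + 2) (M + 3)
        · rw [indicator_of_mem hx']
          have hgx : g (L - 2) ≤ g (x - X) := by
            have := gaussianWeight_le (ε := ε) (a := |x - X|) (t := L - 2) hε0.le (abs_nonneg _) (by
              rw [abs_of_nonneg (by linarith : 0 ≤ L - 2)]
              exact abs_le.2 ⟨by linarith [hx'.1], by linarith [hx'.2]⟩)
            simpa [hg, gaussianWeight] using this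
          have hvm : 1 - v (M + 3) ≤ 1 - v x := by linarith [h.monotone hx'.2]
          have : E ≤ (1 - v x) * (ε * g (x - X)) := by
            rw [hE, mul_comm ε, mul_assoc]
            refine mul_le_mul hvm ?_ (mul_nonneg hε0.le (hg0 _).le) hw0
            exact mul_le_mul_of_nonneg_left hgx hε0.le
          linarith
        · rw [indicator_of_notMem hx']
          linarith [mul_nonneg hw0 (mul_nonneg hε0.le (hg0 (x - X)).le)]
      · have hx' : x ∉ Icc (M + 2) (M + 3) := fun hx' => by
          rcases le_abs.1 hedge with h1 | h1
          · linarith [hx'.2]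
          · linarith [hx'.1]
        rw [indicator_of_notMem hx', sub_zero]
        have hd := (hC L (x - X) (by linarith) habs hedge).trans hDC
        rw [← hφ2] at hd
        have := mul_le_mul_of_nonneg_right hd hw0
        linarith [mul_le_of_le_one_right hD0 hw1]
    · have hx' : x ∉ Icc (M + 2) (M + 3) := fun hx' =>
        hx ⟨by linarith [hx'.1], by linarith [hx'.2]⟩
      rw [indicator_of_notMem hx, indicator_of_notMem hx', sub_zero]
      have hz : φ =ᶠ[𝓝 x] fun _ => (0 : ℝ) := by
        filter_upwards [isClosed_Icc.isOpen_compl.mem_nhds hx] with z hz using hout z hz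
      rw [hz.iteratedDeriv_eq 2]
      simpa using hnl
  have hi1 : Integrable fun x => iteratedDeriv 2 φ x * (1 - v x) := by
    have h2 := integrable_iteratedDeriv hφs hφc 2
    exact (h2.sub (h.integrable_mul_self h2)).congr
      (Eventually.of_forall fun x => (mul_one_sub _ _).symm)
  have hi2 := (h.integrable_mul_correlation hW hφi).const_mul (1 - ε)
  have hI : ∀ a b c : ℝ, Integrable ((Icc a b).indicator fun _ : ℝ => c) := fun a b c =>
    (integrable_indicator_iff measurableSet_Icc).2 (integrable_const _)
  have hint := integral_mono (hi1.sub hi2) ((hI M (M + 2 * L) D).sub (hI (M + 2) (M + 3) E)) hpt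
  simp only [Pi.sub_apply] at hint
  rw [integral_sub hi1 hi2, integral_const_mul, integral_sub (hI _ _ _) (hI _ _ _),
    integral_indicator measurableSet_Icc, integral_indicator measurableSet_Icc,
    setIntegral_const, setIntegral_const, Real.volume_real_Icc_of_le (by linarith),
    Real.volume_real_Icc_of_le (by linarith)] at hint
  simp only [smul_eq_mul] at hint
  have hED : E ≤ 2 * L * D := by linarith
  -- The exponent is `ε ((L - 1)² - (L - 2)²) / 2 = ε (L - 3/2)`: one unit further in, the Gaussian
  -- is exponentially larger.
  have hexp : g (L - 2) = Real.exp (ε * (L - 3 / 2)) * g (L - 1) := by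
    simp only [hg, gaussianWeight]
    rw [← Real.exp_add]
    ring_nf
  rw [hE, hD, hexp] at hED
  have hfin : ε * (1 - v (M + 3)) * Real.exp (ε * (L - 3 / 2)) ≤
      2 * L * ((C + 2) * (1 + L) ^ 2) := by
    refine le_of_mul_le_mul_right ?_ (hg0 (L - 1))
    linarith
  refine hfin.trans ?_
  have : 0 ≤ (C + 2) * (1 + L) ^ 2 := by positivity
  nlinarith

end MonotoneProfile

theorem not_monotoneProfile {W v : ℝ → ℝ} (hW : Integrable W) (heven : ∀ᵐ x, W (-x) = W x)
    (hmass : ∫ x, W x = 1) (hpos : ∀ᵐ x, 0 ≤ W x) {τ σ : ℝ} (hτ : 0 < τ) (hσ : 0 < σ)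
    (hlower : ∀ᵐ x, x ∈ Ioo (-τ) τ → σ ≤ W x)
    (hlap : ∀ s : ℝ, 0 ≤ s → ((s ^ 2 : ℝ) : EReal) - 2 * generalizedLaplace W s < 0) :
    ¬ MonotoneProfile W v := by
  intro h
  obtain ⟨ε, hε, hG⟩ := exists_forall_sq_lt_gaussianLaplace hW heven hpos hτ hσ hlower hlap
  obtain ⟨M, hM⟩ := eventually_atTop.1
    (h.tendsto_atTop.eventually_const_lt (by linarith [hε.1] : 1 - ε < 1))
  obtain ⟨C, hC⟩ := h.mul_exp_le hW hpos hmass hε hG fun x hx => (hM x hx).le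
  have ha : 0 < ε * (1 - v (M + 3)) :=
    mul_pos hε.1 (by linarith [h.lt_one hW hpos hτ hσ hlower (M + 3)])
  have hlim : Tendsto (fun r : ℝ => Real.exp (ε * r) / r ^ (3 : ℝ)) atTop atTop :=
    tendsto_exp_mul_div_rpow_atTop 3 ε hε.1
  -- Here `r = 1 + L`, so `L - 3/2 = r - 5/2` and `r ≥ 5` gives `L ≥ 4`.
  obtain ⟨r, hr, hr5⟩ := ((hlim.eventually_gt_atTop
    (C * Real.exp (ε * (5 / 2)) / (ε * (1 - v (M + 3))))).and (eventually_ge_atTop 5)).exists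
  have hCr := hC (r - 1) (by linarith)
  have hexp : Real.exp (ε * (r - 1 - 3 / 2)) = Real.exp (ε * r) / Real.exp (ε * (5 / 2)) := by
    rw [← Real.exp_sub]; ring_nf
  rw [show (3 : ℝ) = ((3 : ℕ) : ℝ) by norm_num, Real.rpow_natCast,
    div_lt_div_iff₀ (by simpa using ha) (by positivity)] at hr
  push_cast at hr
  rw [hexp, mul_div_assoc', div_le_iff₀ (Real.exp_pos _)] at hCr
  ring_nf at hr hCr
  linarith

theorem corollary1p9 (W : ℝ → ℝ)
    (hW : Integrable W) (hW_even : ∀ᵐ x, W (-x) = W x) (hW_mass : ∫ x, W x = 1)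
    (hW_nonneg : ∀ᵐ x, 0 ≤ W x)
    (hW_lower : ∃ τ > 0, ∃ σ > 0, ∀ᵐ x, x ∈ Ioo (-τ) τ → σ ≤ W x)
    (hW_laplace : ∀ s : ℝ, 0 ≤ s → ((s ^ 2 : ℝ) : EReal) - 2 * generalizedLaplace W s < 0)
    (u : ℝ → ℂ) (hu : MemEnergySpace u) (hu_sol : IsStaticSolution W u)
    (hu_nonconst : ¬ ∃ a : ℂ, ∀ᵐ x, u x = a)
    (hu_top : Tendsto u atTop (𝓝 1)) (hu_bot : Tendsto u atBot (𝓝 (-1))) :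
    ¬ ∃ v : ℝ → ℝ, Monotone v ∧ ∀ᵐ x, u x = (v x : ℂ) := by
  rintro ⟨v, hv, huv⟩
  obtain ⟨τ, hτ, σ, hσ, hlower⟩ := hW_lower
  exact not_monotoneProfile hW hW_even hW_mass hW_nonneg hτ hσ hlower hW_laplace
    (.of_isStaticSolution hv huv hu_sol hu_top hu_bot)
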